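/- **Definitions.** For complex sequences $\mathbf a=(a_0,\dots,a_{L-1})$ and $\mathbf b=(b_0,\dots,b_{L-1})$ of length $L$ and $\tau\in\mathbb Z$, let $$\rho_{\mathbf a,\mathbf b}(\tau)=\sum_{\substack{0\le k,l<L\\ l=k+\tau}}a_k b_l^*,\qquad \rho_{\mathbf a}=\rho_{\mathbf a,\mathbf a},$$ where $^*$ is complex conjugation. The pair $(\mathbf a,\mathbf b)$ is a Golay complementary pair (GCP) if $\rho_{\mathbf a}(\tau)+\rho_{\mathbf b}(\tau)=0$ for all $\tau\neq0$; it is binary if all entries are $\pm1$. A GCP $(\mathbf c,\mathbf d)$ is a complementary mate of $(\mathbf a,\mathbf b)$ if $\rho_{\mathbf a,\mathbf c}(\tau)+\rho_{\mathbf b,\mathbf d}(\tau)=0$ for all $\tau$. The pair $(\mathbf a,\mathbf b)$ is an $(L,Z)$-CZCP (cross Z-complementary pair) if $\rho_{\mathbf a}(\tau)+\rho_{\mathbf b}(\tau)=0$ whenever $|\tau|\in\{1,\dots,Z\}\cup\{L-Z,\dots,L-1\}$, and $\rho_{\mathbf a,\mathbf b}(\tau)+\rho_{\mathbf b,\mathbf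 a}(\tau)=0$ whenever $|\tau|\in\{L-Z,\dots,L-1\}$. Let $\overleftarrow{\mathbf a}$ be the reversal of $\mathbf a$, let $\mathbf a\|\mathbf c$ denote concatenation, and let $\otimes$ be the Kronecker product, $\mathbf c\otimes\mathbf u=(c_0\mathbf u\,\|\,c_1\mathbf u\,\|\cdots)$. For $\mathcal A=(\mathbf a,\mathbf b)$ of length $N$ and $\mathcal B=(\mathbf c,\mathbf d)$ of length $M$, let $\mathrm{Turyn}(\mathcal A,\mathcal B)$ be the pair of length $MN$ $$\Bigl(\mathbf c\otimes\tfrac{\mathbf a+\mathbf b}2-\overleftarrow{\mathbf d}\otimes\tfrac{\mathbf b-\mathbf a}2,\quad \mathbf d\otimes\tfrac{\mathbf a+\mathbf b}2+\overleftarrow{\mathbf c}\otimes\tfrac{\mathbf b-\mathbf a}2\Bigr).$$ Writing $\pm$ for $\pm1$, let $$K_{10}=\begin{pmatrix}{+}{+}{-}{+}{-}{+}{-}{-}{+}{+}\\{+}{+}{-}{+}{+}{+}{+}{+}{-}{-}\end{pmatrix},$$ $$K_{26}=\begin{pmatrix}{+}{+}{+}{+}{-}{+}{+}{-}{-}{+}{-}{+}{-}{+}{-}{-}{+}{-}{+}{+}{+}{-}{-}{+}{+}{+}\\{+}{+}{+}{+}{-}{+}{+}{-}{-}{+}{-}{+}{+}{+}{+}{+}{-}{+}{-}{-}{-}{+}{+}{-}{-}{-}\end{pmatrix}.$$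 **Theorem.** Let $(\mathbf a,\mathbf b)$ be a pair of length $N$, and let $Z$ be a number, such that one of the following holds: 1. $N=10^\beta$ with $\beta\ge1$; $(\mathbf a,\mathbf b)$ is obtained from $K_{10}$ by finitely many (possibly zero) steps $\mathcal B\mapsto\mathrm{Turyn}(K_{10},\mathcal B)$; and $Z=4N/10+1$. 2. $N=26^\gamma$ with $\gamma\ge1$; $(\mathbf a,\mathbf b)$ is obtained from $K_{26}$ by finitely many (possibly zero) steps $\mathcal B\mapsto\mathrm{Turyn}(K_{26},\mathcal B)$; and $Z=12N/26+1$. 3. $N=10^\beta26^\gamma$ with $\beta\ge0$, $\gamma\ge1$; $(\mathbf a,\mathbf b)$ is obtained from $K_{26}$ by finitely many (possibly zero) steps $\mathcal B\mapsto\mathrm{Turyn}(\mathcal A,\mathcal B)$, where in each step $\mathcal A$ is $K_{10}$ or $K_{26}$, in any order; and $Z=12N/26+1$. Let $(\mathbf c,\mathbf d)=(\overleftarrow{\mathbf b^*},-\overleftarrow{\mathbf a^*})$, $\mathbf e=\mathbf a\|\mathbf c$ and $\mathbf f=\mathbf b\|\mathbf d$. Let $q\ge2$, let $x_0,y_0,x_1,y_1$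 be complex $q$-th roots of unity with $$x_0-y_1^*=0,\quad x_1+y_0^*=0,\quad x_0=x_1,\quad y_0^*=-y_1^*,$$ and set $\mathbf g=(x_0,e_0,\dots,e_{2N-1},y_0)$ and $\mathbf h=(x_1,f_0,\dots,f_{2N-1},y_1)$. Then $(\mathbf a,\mathbf b)$ is a binary GCP, $(\mathbf c,\mathbf d)$ is a complementary mate of it, and $(\mathbf g,\mathbf h)$ is a $(2N+2,Z)$-CZCP. -/

import Mathlib

/-- A pair of complex sequences of length `N`, indexed from `0`. -/
abbrev SeqPair (N : ℕ) : Type := (Fin N → ℂ) × (Fin N → ℂ)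

/-- The aperiodic cross-correlation of two sequences of length `N` at the integer shift `τ`:
the sum of `a k * conj (b l)` over all indices `0 ≤ k, l < N` with `l = k + τ`.
It is `0` when `|τ| ≥ N`. -/
noncomputable def aperiodicCorr {N : ℕ} (a b : Fin N → ℂ) (τ : ℤ) : ℂ :=
  ∑ k : Fin N, ∑ l : Fin N,
    if (l : ℤ) = (k : ℤ) + τ then a k * starRingEnd ℂ (b l) else 0

/-- Golay complementary pair: the autocorrelation sums vanish at every nonzero shift. -/
def IsGCP {N : ℕ} (a b : Fin N → ℂ) : Prop :=
  ∀ τ : ℤ, τ ≠ 0 → aperiodicCorr a a τ + aperiodicCorr b b τ = 0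

/-- A sequence is binary if its entries are `1` or `-1`. -/
def IsBinary {N : ℕ} (a : Fin N → ℂ) : Prop := ∀ i, a i = 1 ∨ a i = -1

/-- `(c, d)` is a complementary mate of `(a, b)`: a GCP whose cross-correlation sums with
`(a, b)` vanish at every shift. -/
def IsComplementaryMate {N : ℕ} (a b c d : Fin N → ℂ) : Prop :=
  IsGCP c d ∧ ∀ τ : ℤ, aperiodicCorr a c τ + aperiodicCorr b d τ = 0

/-- The reverse of a sequence. -/
def seqReverse {N : ℕ} (a : Fin N → ℂ) : Fin N → ℂ := fun i => a i.rev

/-- The complementary mate `(reverse b*, -reverse a*)` of `(a, b)`. -/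
noncomputable def mate {N : ℕ} (P : SeqPair N) : SeqPair N :=
  (fun i => starRingEnd ℂ (seqReverse P.2 i), fun i => -starRingEnd ℂ (seqReverse P.1 i))

/-- `(g, h)` is an `(L, Z)`-CZCP: zero autocorrelation sums for all shifts `τ` with
`|τ| ∈ {1, …, Z} ∪ {L - Z, …, L - 1}`, and zero cross-correlation sums for all shifts with
`|τ| ∈ {L - Z, …, L - 1}`. -/
def IsCZCP (L Z : ℕ) (g h : Fin L → ℂ) : Prop :=
  (∀ τ : ℤ, (1 ≤ |τ| ∧ |τ| ≤ (Z : ℤ)) ∨ ((L : ℤ) - Z ≤ |τ| ∧ |τ| ≤ (L : ℤ) - 1) →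
    aperiodicCorr g g τ + aperiodicCorr h h τ = 0) ∧
  (∀ τ : ℤ, (L : ℤ) - Z ≤ |τ| ∧ |τ| ≤ (L : ℤ) - 1 →
    aperiodicCorr g h τ + aperiodicCorr h g τ = 0)

/-- The kernel GCP of length `10`. -/
noncomputable def K10 : SeqPair 10 :=
  (![1, 1, -1, 1, -1, 1, -1, -1, 1, 1],
   ![1, 1, -1, 1, 1, 1, 1, 1, -1, -1])

/-- The kernel GCP of length `26`. -/
noncomputable def K26 : SeqPair 26 :=
  (![1, 1, 1, 1, -1, 1, 1, -1, -1, 1, -1, 1, -1, 1, -1, -1, 1, -1, 1, 1, 1, -1, -1, 1, 1, 1],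
   ![1, 1, 1, 1, -1, 1, 1, -1, -1, 1, -1, 1, 1, 1, 1, 1, -1, 1, -1, -1, -1, 1, 1, -1, -1, -1])

/-- The Kronecker product of a sequence `c` of length `M` and a sequence `u` of length `N`:
the concatenation of the blocks `c 0 • u, c 1 • u, …`. -/
noncomputable def seqKron {M N : ℕ} (c : Fin M → ℂ) (u : Fin N → ℂ) : Fin (M * N) → ℂ :=
  fun p => c p.divNat * u p.modNat

/-- Turyn's method with first pair `A = (a, b)` and second pair `B = (c, d)`:
`(c ⊗ (a + b) / 2 - reverse d ⊗ (b - a) / 2, d ⊗ (a + b) / 2 + reverse c ⊗ (b - a) / 2)`. -/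
noncomputable def turyn {N M : ℕ} (A : SeqPair N) (B : SeqPair M) : SeqPair (M * N) :=
  (fun p => seqKron B.1 (fun j => (A.1 j + A.2 j) / 2) p
      - seqKron (seqReverse B.2) (fun j => (A.2 j - A.1 j) / 2) p,
   fun p => seqKron B.2 (fun j => (A.1 j + A.2 j) / 2) p
      + seqKron (seqReverse B.1) (fun j => (A.2 j - A.1 j) / 2) p)

/-- Pairs built by iterating Turyn's method on `K10`, starting from `K10`. -/
inductive IsTuryn10 : {N : ℕ} → SeqPair N → Prop
  | base : IsTuryn10 K10
  | step {N : ℕ} {B : SeqPair N} (hB : IsTuryn10 B) : IsTuryn10 (turyn K10 B)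

/-- Pairs built by iterating Turyn's method on `K26`, starting from `K26`. -/
inductive IsTuryn26 : {N : ℕ} → SeqPair N → Prop
  | base : IsTuryn26 K26
  | step {N : ℕ} {B : SeqPair N} (hB : IsTuryn26 B) : IsTuryn26 (turyn K26 B)

/-- Pairs built from `K26` by finitely many steps of Turyn's method, the first pair in each step
being `K10` or `K26`, in any order. -/
inductive IsTurynMixed : {N : ℕ} → SeqPair N → Prop
  | base : IsTurynMixed K26
  | step10 {N : ℕ} {B : SeqPair N} (hB : IsTurynMixed B) : IsTurynMixed (turyn K10 B)
  | step26 {N : ℕ} {B : SeqPair N} (hB : IsTurynMixed B) : IsTurynMixed (turyn K26 B)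

/-- The symmetric insertion at position `0`: the sequence `(x, e 0, …, e (n - 1), y)`. -/
def insertEnds {n : ℕ} (e : Fin n → ℂ) (x y : ℂ) : Fin (n + 2) → ℂ :=
  Fin.cons (α := fun _ => ℂ) x (Fin.snoc (α := fun _ => ℂ) e y)

/-- The set of complex `q`-th roots of unity `exp (2 π i t / q)`, `0 ≤ t < q`. -/
def rootsU (q : ℕ) : Set ℂ :=
  {z | ∃ t : ℕ, t < q ∧ z = Complex.exp (2 * Real.pi * Complex.I * t / q)}

/-- The Laurent polynomial `∑ k, a k * T ^ (n * k)` of a sequence `a`, dilated by `n`. -/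
noncomputable def laurentSum {N : ℕ} (n : ℤ) (a : Fin N → ℂ) : LaurentPolynomial ℂ :=
  ∑ k : Fin N, LaurentPolynomial.C (a k) * LaurentPolynomial.T (n * k)

/-- The entrywise complex conjugate of a sequence. -/
noncomputable def conjSeq {N : ℕ} (a : Fin N → ℂ) : Fin N → ℂ := fun i => starRingEnd ℂ (a i)

open LaurentPolynomial in
theorem laurentSum_mul_conj {N : ℕ} (n : ℤ) (a b : Fin N → ℂ) :
    laurentSum n a * laurentSum (-n) (conjSeq b) =
      ∑ τ ∈ Finset.Icc (-(N : ℤ)) N, C (aperiodicCorr a b τ) * T (-(n * τ)) := by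
  simp only [laurentSum, aperiodicCorr, map_sum]
  rw [Finset.sum_mul_sum]
  simp only [Finset.sum_mul]
  symm
  refine Finset.sum_comm.trans (Finset.sum_congr rfl fun k _ => ?_)
  refine Finset.sum_comm.trans (Finset.sum_congr rfl fun l _ => ?_)
  rw [Finset.sum_eq_single ((l : ℤ) - k)]
  · rw [if_pos (by ring), map_mul]
    have : -(n * ((l : ℤ) - k)) = n * k + -n * l := by ring
    rw [this, T_add]
    simp only [conjSeq]
    ring
  · intro τ _ hτ
    rw [if_neg (fun h => hτ (by omega))]
    simp
  · intro h
    exact absurd (Finset.mem_Icc.2 ⟨by omega, by omega⟩) h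

theorem aperiodicCorr_eq_zero_of_lt {N : ℕ} (a b : Fin N → ℂ) {τ : ℤ} (h : (N : ℤ) < |τ|) :
    aperiodicCorr a b τ = 0 := by
  refine Finset.sum_eq_zero fun k _ => Finset.sum_eq_zero fun l _ => if_neg fun hl => ?_
  rcases lt_abs.1 h with h | h <;> omega

theorem coeff_C_mul_T (x : ℂ) (m n : ℤ) :
    (LaurentPolynomial.C x * LaurentPolynomial.T n).coeff m = if n = m then x else 0 := by
  rw [← LaurentPolynomial.single_eq_C_mul_T, AddMonoidAlgebra.coeff_single, Finsupp.single_apply]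

theorem coeff_laurentSum_mul_conj {N : ℕ} (a b : Fin N → ℂ) (τ : ℤ) :
    (laurentSum 1 a * laurentSum (-1) (conjSeq b)).coeff (-τ) = aperiodicCorr a b τ := by
  rw [laurentSum_mul_conj]
  simp only [one_mul, AddMonoidAlgebra.coeff_sum, Finsupp.finsetSum_apply, coeff_C_mul_T, neg_inj]
  by_cases h : |τ| ≤ N
  · rw [abs_le] at h
    simp [h.1, h.2]
  · rw [aperiodicCorr_eq_zero_of_lt a b (not_le.1 h)]
    rw [abs_le, not_and_or] at h
    simp
    omega

theorem IsGCP.exists_laurentSum_eq_C {N : ℕ} {a b : Fin N → ℂ} (h : IsGCP a b) (n : ℤ) :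
    laurentSum n a * laurentSum (-n) (conjSeq a) + laurentSum n b * laurentSum (-n) (conjSeq b) =
      LaurentPolynomial.C (aperiodicCorr a a 0 + aperiodicCorr b b 0) := by
  rw [laurentSum_mul_conj, laurentSum_mul_conj, ← Finset.sum_add_distrib]
  rw [Finset.sum_eq_single 0]
  · simp
  · intro τ _ hτ
    rw [← add_mul, ← map_add, h τ hτ]
    simp
  · intro h
    exact absurd (Finset.mem_Icc.2 ⟨by omega, by omega⟩) h

theorem isGCP_of_laurentSum_eq_C {N : ℕ} {a b : Fin N → ℂ} {w : ℂ}
    (h : laurentSum 1 a * laurentSum (-1) (conjSeq a) +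
      laurentSum 1 b * laurentSum (-1) (conjSeq b) = LaurentPolynomial.C w) : IsGCP a b := by
  intro τ hτ
  rw [← coeff_laurentSum_mul_conj, ← coeff_laurentSum_mul_conj, ← Finsupp.add_apply,
    ← AddMonoidAlgebra.coeff_add, h, ← mul_one (LaurentPolynomial.C w), ← LaurentPolynomial.T_zero,
    coeff_C_mul_T, if_neg (by omega)]

theorem aperiodicCorr_add_eq_zero_of_laurentSum {N : ℕ} {a b c d : Fin N → ℂ}
    (h : laurentSum 1 a * laurentSum (-1) (conjSeq c) +
      laurentSum 1 b * laurentSum (-1) (conjSeq d) = 0) (τ : ℤ) :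
    aperiodicCorr a c τ + aperiodicCorr b d τ = 0 := by
  rw [← coeff_laurentSum_mul_conj, ← coeff_laurentSum_mul_conj, ← Finsupp.add_apply,
    ← AddMonoidAlgebra.coeff_add, h]
  simp

@[simp] theorem conjSeq_conjSeq {N : ℕ} (a : Fin N → ℂ) : conjSeq (conjSeq a) = a := by
  funext i
  simp [conjSeq]

theorem conjSeq_seqReverse {N : ℕ} (a : Fin N → ℂ) :
    conjSeq (seqReverse a) = seqReverse (conjSeq a) := rfl

theorem laurentSum_neg {N : ℕ} (n : ℤ) (a : Fin N → ℂ) :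
    laurentSum n (fun i => -a i) = -laurentSum n a := by
  simp [laurentSum]

open LaurentPolynomial in
theorem laurentSum_seqReverse {N : ℕ} (n : ℤ) (a : Fin N → ℂ) :
    laurentSum n (seqReverse a) = T (n * (N - 1)) * laurentSum (-n) a := by
  unfold laurentSum
  rw [← Equiv.sum_comp Fin.revPerm, Finset.mul_sum]
  refine Finset.sum_congr rfl fun k _ => ?_
  have hk : (((Fin.rev k : Fin N) : ℕ) : ℤ) = N - 1 - k := by
    rw [Fin.val_rev]
    omega
  have : n * ((N : ℤ) - 1 - k) = n * (N - 1) + -n * k := by ring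
  simp only [seqReverse, Fin.revPerm_apply, Fin.rev_rev]
  rw [hk, this, T_add]
  ring

open LaurentPolynomial in
theorem laurentSum_append {M N : ℕ} (n : ℤ) (a : Fin M → ℂ) (b : Fin N → ℂ) :
    laurentSum n (Fin.append a b) = laurentSum n a + T (n * M) * laurentSum n b := by
  simp only [laurentSum, Fin.sum_univ_add, Fin.append_left, Fin.append_right, Finset.mul_sum]
  congr 1
  refine Finset.sum_congr rfl fun k _ => ?_
  simp only [Fin.val_natAdd, Nat.cast_add, mul_add, T_add]
  ring

theorem conjSeq_append {M N : ℕ} (a : Fin M → ℂ) (b : Fin N → ℂ) :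
    conjSeq (Fin.append a b) = Fin.append (conjSeq a) (conjSeq b) := by
  funext i
  refine Fin.addCases (fun j => ?_) (fun j => ?_) i <;> simp [conjSeq]

open LaurentPolynomial in
theorem laurentSum_seqKron {M N : ℕ} (n : ℤ) (c : Fin M → ℂ) (u : Fin N → ℂ) :
    laurentSum n (seqKron c u) = laurentSum (n * N) c * laurentSum n u := by
  unfold laurentSum
  rw [← Equiv.sum_comp finProdFinEquiv, Fintype.sum_prod_type, Finset.sum_mul_sum]
  refine Finset.sum_congr rfl fun k _ => Finset.sum_congr rfl fun l _ => ?_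
  have h : finProdFinEquiv.symm (finProdFinEquiv (k, l)) = (k, l) := Equiv.symm_apply_apply _ _
  have h₁ : (finProdFinEquiv (k, l)).divNat = k := congrArg Prod.fst h
  have h₂ : (finProdFinEquiv (k, l)).modNat = l := congrArg Prod.snd h
  simp only [seqKron, h₁, h₂, finProdFinEquiv_apply_val, map_mul]
  have : n * (((l + N * k : ℕ) : ℕ) : ℤ) = n * N * k + n * l := by push_cast; ring
  rw [this, T_add]
  ring

theorem laurentSum_add {N : ℕ} (n : ℤ) (a b : Fin N → ℂ) :
    laurentSum n (fun i => a i + b i) = laurentSum n a + laurentSum n b := by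
  simp [laurentSum, add_mul, Finset.sum_add_distrib]

theorem laurentSum_sub {N : ℕ} (n : ℤ) (a b : Fin N → ℂ) :
    laurentSum n (fun i => a i - b i) = laurentSum n a - laurentSum n b := by
  simp [laurentSum, sub_mul, Finset.sum_sub_distrib]

theorem laurentSum_div {N : ℕ} (n : ℤ) (a : Fin N → ℂ) (w : ℂ) :
    laurentSum n (fun i => a i / w) = LaurentPolynomial.C w⁻¹ * laurentSum n a := by
  simp only [laurentSum, Finset.mul_sum, div_eq_inv_mul, map_mul, mul_assoc]

open LaurentPolynomial in
theorem IsGCP.isComplementaryMate_mate {N : ℕ} {a b : Fin N → ℂ} (h : IsGCP a b) :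
    IsComplementaryMate a b (mate (a, b)).1 (mate (a, b)).2 := by
  have h₁ : (mate (a, b)).1 = conjSeq (seqReverse b) := rfl
  have h₂ : (mate (a, b)).2 = fun i => -conjSeq (seqReverse a) i := rfl
  have h₃ : conjSeq (mate (a, b)).2 = fun i => -seqReverse a i := by
    funext i
    simp [conjSeq, mate]
  constructor
  · refine isGCP_of_laurentSum_eq_C (w := aperiodicCorr a a 0 + aperiodicCorr b b 0) ?_
    rw [← h.exists_laurentSum_eq_C 1, h₃, h₁, h₂, laurentSum_neg, laurentSum_neg,
      conjSeq_conjSeq]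
    simp only [conjSeq_seqReverse, laurentSum_seqReverse, neg_neg]
    have hT : (T (1 * ((N : ℤ) - 1)) : LaurentPolynomial ℂ) * T (-1 * ((N : ℤ) - 1)) = 1 := by
      rw [← T_add, ← T_zero]
      congr 1
      ring
    linear_combination (laurentSum (-1) (conjSeq a) * laurentSum 1 a +
      laurentSum (-1) (conjSeq b) * laurentSum 1 b) * hT
  · refine aperiodicCorr_add_eq_zero_of_laurentSum ?_
    rw [h₃, h₁, laurentSum_neg, conjSeq_conjSeq]
    simp only [laurentSum_seqReverse, neg_neg]
    ring

open LaurentPolynomial in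
theorem IsGCP.append_mate {N : ℕ} {a b : Fin N → ℂ} (h : IsGCP a b) :
    IsGCP (Fin.append a (mate (a, b)).1) (Fin.append b (mate (a, b)).2) := by
  have h₁ : (mate (a, b)).1 = conjSeq (seqReverse b) := rfl
  have h₂ : (mate (a, b)).2 = fun i => -conjSeq (seqReverse a) i := rfl
  have h₃ : conjSeq (mate (a, b)).2 = fun i => -seqReverse a i := by
    funext i
    simp [conjSeq, mate]
  set w := aperiodicCorr a a 0 + aperiodicCorr b b 0 with hw
  refine isGCP_of_laurentSum_eq_C (w := w + w) ?_
  have H := h.exists_laurentSum_eq_C 1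
  have hT (m : ℤ) : (T (1 * m) : LaurentPolynomial ℂ) * T (-1 * m) = 1 := by
    rw [← T_add, ← T_zero]
    congr 1
    ring
  rw [conjSeq_append, conjSeq_append, h₃, h₁, h₂, map_add, ← H]
  simp only [laurentSum_append, laurentSum_neg, conjSeq_conjSeq]
  simp only [conjSeq_seqReverse, laurentSum_seqReverse, neg_neg]
  linear_combination (laurentSum (-1) (conjSeq a) * laurentSum 1 a +
      laurentSum (-1) (conjSeq b) * laurentSum 1 b) *
      (T (1 * (N - 1 : ℤ)) * T (-1 * (N - 1 : ℤ)) * hT N + hT (N - 1))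

open LaurentPolynomial in
theorem IsGCP.turyn {N M : ℕ} {A : SeqPair N} {B : SeqPair M} (hA : IsGCP A.1 A.2)
    (hB : IsGCP B.1 B.2) (hA₁ : conjSeq A.1 = A.1) (hA₂ : conjSeq A.2 = A.2)
    (hB₁ : conjSeq B.1 = B.1) (hB₂ : conjSeq B.2 = B.2) :
    IsGCP (turyn A B).1 (turyn A B).2 := by
  have r (x : Fin N → ℂ) (hx : conjSeq x = x) (i : Fin N) : starRingEnd ℂ (x i) = x i :=
    congrFun hx i
  have s (x : Fin M → ℂ) (hx : conjSeq x = x) (i : Fin M) : starRingEnd ℂ (x i) = x i :=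
    congrFun hx i
  have e₁ : conjSeq (_root_.turyn A B).1 = (_root_.turyn A B).1 := by
    funext p
    simp [conjSeq, _root_.turyn, seqKron, seqReverse, r _ hA₁, r _ hA₂, s _ hB₁, s _ hB₂, Complex.conj_ofNat]
  have e₂ : conjSeq (_root_.turyn A B).2 = (_root_.turyn A B).2 := by
    funext p
    simp [conjSeq, _root_.turyn, seqKron, seqReverse, r _ hA₁, r _ hA₂, s _ hB₁, s _ hB₂, Complex.conj_ofNat]
  have HA := hA.exists_laurentSum_eq_C 1
  have HB := hB.exists_laurentSum_eq_C (1 * N)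
  set wA := aperiodicCorr A.1 A.1 0 + aperiodicCorr A.2 A.2 0
  set wB := aperiodicCorr B.1 B.1 0 + aperiodicCorr B.2 B.2 0
  refine isGCP_of_laurentSum_eq_C (w := 2⁻¹ * wA * wB) ?_
  rw [e₁, e₂]
  rw [hA₁, hA₂] at HA
  rw [hB₁, hB₂] at HB
  have hT : (T (1 * N * ((M : ℤ) - 1)) : LaurentPolynomial ℂ) * T (-1 * N * ((M : ℤ) - 1)) = 1 := by
    rw [← T_add, ← T_zero]
    congr 1
    ring
  have h2 : (C (2⁻¹ : ℂ) : LaurentPolynomial ℂ) * 2 = 1 := by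
    rw [← map_ofNat (C : ℂ →+* LaurentPolynomial ℂ) 2, ← map_mul]
    norm_num
  rw [map_mul, map_mul, ← HA, ← HB]
  simp only [_root_.turyn, laurentSum_add, laurentSum_sub, laurentSum_seqKron, laurentSum_div,
    laurentSum_seqReverse]
  simp only [neg_mul, neg_neg] at hT ⊢
  generalize (C (2⁻¹ : ℂ) : LaurentPolynomial ℂ) = t at *
  generalize (T (1 * N * ((M : ℤ) - 1)) : LaurentPolynomial ℂ) = X at *
  generalize (T (-(1 * N * ((M : ℤ) - 1))) : LaurentPolynomial ℂ) = Y at *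
  generalize laurentSum (1 * (N : ℤ)) B.1 = c at *
  generalize laurentSum (-(1 * (N : ℤ))) B.1 = c' at *
  generalize laurentSum (1 * (N : ℤ)) B.2 = d at *
  generalize laurentSum (-(1 * (N : ℤ))) B.2 = d' at *
  generalize laurentSum 1 A.1 = a at *
  generalize laurentSum (-1) A.1 = a' at *
  generalize laurentSum 1 A.2 = b at *
  generalize laurentSum (-1) A.2 = b' at *
  linear_combination (c * c' + d * d') * t ^ 2 * (b - a) * (b' - a') * hT +
    t * (a * a' + b * b') * (c * c' + d * d') * h2

/-- The autocorrelation of an integer sequence, computable by evaluation. -/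
def intCorr {N : ℕ} (a : Fin N → ℤ) (t : ℕ) : ℤ :=
  ∑ k : Fin N, if h : k + t < N then a k * a ⟨k + t, h⟩ else 0

theorem aperiodicCorr_neg {N : ℕ} (a b : Fin N → ℂ) (τ : ℤ) :
    aperiodicCorr a b (-τ) = starRingEnd ℂ (aperiodicCorr b a τ) := by
  simp only [aperiodicCorr, map_sum]
  rw [Finset.sum_comm]
  refine Finset.sum_congr rfl fun k _ => Finset.sum_congr rfl fun l _ => ?_
  by_cases h : (l : ℤ) = k + τ
  · rw [if_pos h, if_pos (by omega)]
    simp [mul_comm]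
  · rw [if_neg h, if_neg (by omega)]
    simp

theorem aperiodicCorr_intCast {N : ℕ} (a : Fin N → ℤ) (t : ℕ) :
    aperiodicCorr (fun i => (a i : ℂ)) (fun i => (a i : ℂ)) t = intCorr a t := by
  simp only [aperiodicCorr, intCorr, Int.cast_sum]
  refine Finset.sum_congr rfl fun k _ => ?_
  split_ifs with h
  · rw [Finset.sum_eq_single ⟨k + t, h⟩]
    · simp
    · intro l _ hl
      exact if_neg fun h' => hl (Fin.ext (by simp only; omega))
    · simp
  · rw [Int.cast_zero]
    exact Finset.sum_eq_zero fun l _ => if_neg fun h' => h (by omega)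

theorem isGCP_intCast {N : ℕ} {a b : Fin N → ℤ}
    (h : ∀ t : Fin N, (t : ℕ) = 0 ∨ intCorr a t + intCorr b t = 0) :
    IsGCP (fun i => (a i : ℂ)) (fun i => (b i : ℂ)) := by
  have key (t : ℕ) (ht : t ≠ 0) : aperiodicCorr (fun i => (a i : ℂ)) (fun i => (a i : ℂ)) t +
      aperiodicCorr (fun i => (b i : ℂ)) (fun i => (b i : ℂ)) t = 0 := by
    rw [aperiodicCorr_intCast, aperiodicCorr_intCast, ← Int.cast_add]
    by_cases htN : t < N
    · rw [(h ⟨t, htN⟩).resolve_left ht, Int.cast_zero]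
    · have (x : Fin N → ℤ) : intCorr x t = 0 :=
        Finset.sum_eq_zero fun k _ => dif_neg (by omega)
      simp [this]
  intro τ hτ
  obtain ⟨t, rfl | rfl⟩ := τ.eq_nat_or_neg
  · exact key t (by omega)
  · rw [aperiodicCorr_neg, aperiodicCorr_neg, ← map_add, key t (by omega), map_zero]

theorem isBinary_K10 : IsBinary K10.1 ∧ IsBinary K10.2 := by
  simp [IsBinary, K10, Fin.forall_fin_succ]

theorem isBinary_K26 : IsBinary K26.1 ∧ IsBinary K26.2 := by
  simp [IsBinary, K26, Fin.forall_fin_succ]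

theorem isGCP_K10 : IsGCP K10.1 K10.2 := by
  have h := isGCP_intCast (a := ![1, 1, -1, 1, -1, 1, -1, -1, 1, 1])
    (b := ![1, 1, -1, 1, 1, 1, 1, 1, -1, -1]) (by decide +kernel)
  convert h using 1 <;>
  · rw [funext_iff]
    simp [K10, Fin.forall_fin_succ]

theorem isGCP_K26 : IsGCP K26.1 K26.2 := by
  have h := isGCP_intCast (a := ![1, 1, 1, 1, -1, 1, 1, -1, -1, 1, -1, 1, -1, 1, -1, -1, 1, -1, 1,
      1, 1, -1, -1, 1, 1, 1])
    (b := ![1, 1, 1, 1, -1, 1, 1, -1, -1, 1, -1, 1, 1, 1, 1, 1, -1, 1, -1, -1, -1, 1, 1, -1, -1,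
      -1]) (by decide +kernel)
  convert h using 1 <;>
  · rw [funext_iff]
    simp [K26, Fin.forall_fin_succ]

/-- The pair agrees on its first `r / s` of entries and is opposite on its last `r / s`. -/
def AgreeOppose (r s : ℕ) {M : ℕ} (B : SeqPair M) : Prop :=
  ∀ i : Fin M, s * i < r * M → B.1 i = B.2 i ∧ B.1 i.rev = -B.2 i.rev

theorem divNat_rev {M N : ℕ} (p : Fin (M * N)) : p.rev.divNat = p.divNat.rev := by
  obtain ⟨⟨i, j⟩, rfl⟩ := finProdFinEquiv.surjective p
  have h (x : Fin M × Fin N) : (finProdFinEquiv x).divNat = x.1 :=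
    congrArg Prod.fst (finProdFinEquiv.symm_apply_apply x)
  have : (finProdFinEquiv (i, j)).rev = finProdFinEquiv (i.rev, j.rev) := by
    ext
    simp only [Fin.val_rev, finProdFinEquiv_apply_val]
    obtain ⟨k, hk⟩ := Nat.exists_eq_add_of_lt i.2
    obtain ⟨l, hl⟩ := Nat.exists_eq_add_of_lt j.2
    rw [Nat.sub_eq_of_eq_add (show N = l + (j + 1) by omega),
      Nat.sub_eq_of_eq_add (show M = k + (i + 1) by omega)]
    refine Nat.sub_eq_of_eq_add ?_
    have : M * N = (i + k + 1) * N := by rw [← hk]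
    linear_combination this + hl
  rw [this, h, h]

theorem AgreeOppose.turyn {r s N M : ℕ} {B : SeqPair M} (hB : AgreeOppose r s B)
    (A : SeqPair N) : AgreeOppose r s (turyn A B) := by
  intro p hp
  have hi : s * p.divNat < r * M := by
    have h₁ : (p.divNat : ℕ) * N ≤ p := Nat.div_mul_le_self _ _
    by_contra h
    have := Nat.mul_le_mul_right N (not_lt.1 h)
    nlinarith
  obtain ⟨h₁, h₂⟩ := hB _ hi
  simp only [_root_.turyn, seqKron, seqReverse, divNat_rev, Fin.rev_rev, h₁, h₂]
  constructor <;> ring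

theorem agreeOppose_K10 : AgreeOppose 4 10 K10 := by
  simp [AgreeOppose, K10, Fin.forall_fin_succ, Fin.rev]

theorem agreeOppose_K26 : AgreeOppose 12 26 K26 := by
  simp [AgreeOppose, K26, Fin.forall_fin_succ, Fin.rev]

theorem IsBinary.turyn {N M : ℕ} {A : SeqPair N} {B : SeqPair M} (hA₁ : IsBinary A.1)
    (hA₂ : IsBinary A.2) (hB₁ : IsBinary B.1) (hB₂ : IsBinary B.2) :
    IsBinary (turyn A B).1 ∧ IsBinary (turyn A B).2 := by
  constructor <;> intro p <;> simp only [_root_.turyn, seqKron, seqReverse] <;>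
  rcases hA₁ p.modNat with h₁ | h₁ <;> rcases hA₂ p.modNat with h₂ | h₂ <;>
  rcases hB₁ p.divNat with h₃ | h₃ <;> rcases hB₂ p.divNat with h₄ | h₄ <;>
  rcases hB₁ p.divNat.rev with h₅ | h₅ <;> rcases hB₂ p.divNat.rev with h₆ | h₆ <;>
  rw [h₁, h₂] <;> simp only [h₃, h₄, h₅, h₆] <;> norm_num

theorem aperiodicCorr_insertEnds {n : ℕ} (e f : Fin n → ℂ) (x y x' y' : ℂ) (j : Fin n) :
    aperiodicCorr (insertEnds e x y) (insertEnds f x' y') (j + 1) =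
      aperiodicCorr e f (j + 1) + x * starRingEnd ℂ (f j) + e j.rev * starRingEnd ℂ y' := by
  have h₁ (l : Fin n) : ((l : ℤ) + 1 = j + 1) ↔ l = j := by rw [Fin.ext_iff]; omega
  have h₂ (k : Fin n) : ((n : ℤ) + 1 = k + 1 + (j + 1)) ↔ k = j.rev := by
    rw [Fin.ext_iff, Fin.val_rev]; omega
  have h₃ (k l : Fin n) : ((l : ℤ) + 1 = k + 1 + (j + 1)) ↔ (l : ℤ) = k + (j + 1) := by omega
  have h₄ : ¬ (0 : ℤ) = j + 1 := by omega
  have h₅ (k : Fin n) : ¬ (0 : ℤ) = k + 1 + (j + 1) := by omega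
  have h₆ : ¬ (n : ℤ) + 1 = j + 1 := by omega
  have h₇ (l : Fin n) : ¬ (l : ℤ) + 1 = n + 1 + (j + 1) := by omega
  have h₈ : ¬ (n : ℤ) + 1 = n + 1 + (j + 1) := by omega
  have h₉ : ¬ (0 : ℤ) = n + 1 + (j + 1) := by omega
  simp [aperiodicCorr, insertEnds, Fin.sum_univ_succ (n := n + 1), Fin.sum_univ_castSucc (n := n),
    -Fin.castSucc_succ, h₁, h₂, h₃, h₄, h₅, h₆, h₇, h₈, h₉,
    Finset.sum_add_distrib]
  ring

theorem aperiodicCorr_insertEnds_last {n : ℕ} (e f : Fin n → ℂ) (x y x' y' : ℂ) :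
    aperiodicCorr (insertEnds e x y) (insertEnds f x' y') (n + 1) = x * starRingEnd ℂ y' := by
  have h₁ (l : Fin n) : ¬ ((l : ℤ) + 1 = n + 1) := by omega
  have h₃ (k l : Fin n) : ¬ ((l : ℤ) + 1 = k + 1 + (n + 1)) := by omega
  have h₄ : ¬ (0 : ℤ) = n + 1 := by omega
  have h₅ (k : Fin n) : ¬ (0 : ℤ) = k + 1 + (n + 1) := by omega
  have h₇ (l : Fin n) : ¬ (l : ℤ) + 1 = n + 1 + (n + 1) := by omega
  have h₉ : ¬ (0 : ℤ) = n + 1 + (n + 1) := by omega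
  simp [aperiodicCorr, insertEnds, Fin.sum_univ_succ (n := n + 1), Fin.sum_univ_castSucc (n := n),
    -Fin.castSucc_succ, h₁, h₃, h₄, h₅, h₇, h₉]

theorem isCZCP_of_pos {L Z : ℕ} {g h : Fin L → ℂ}
    (h₁ : ∀ t : ℕ, 1 ≤ t ∧ t ≤ Z ∨ L ≤ t + Z ∧ t + 1 ≤ L →
      t ≠ 0 → aperiodicCorr g g t + aperiodicCorr h h t = 0)
    (h₂ : ∀ t : ℕ, L ≤ t + Z → t + 1 ≤ L → aperiodicCorr g h t + aperiodicCorr h g t = 0)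
    (hZ : Z < L) : IsCZCP L Z g h := by
  constructor
  · intro τ hτ
    obtain ⟨t, rfl | rfl⟩ := τ.eq_nat_or_neg
    · rw [Nat.abs_cast] at hτ
      exact h₁ t (by omega) (by omega)
    · rw [abs_neg, Nat.abs_cast] at hτ
      rw [aperiodicCorr_neg, aperiodicCorr_neg, ← map_add, h₁ t (by omega) (by omega), map_zero]
  · intro τ hτ
    obtain ⟨t, rfl | rfl⟩ := τ.eq_nat_or_neg
    · rw [Nat.abs_cast] at hτ
      exact h₂ t (by omega) (by omega)
    · rw [abs_neg, Nat.abs_cast] at hτ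
      rw [aperiodicCorr_neg, aperiodicCorr_neg, ← map_add, add_comm, h₂ t (by omega) (by omega),
        map_zero]

/-- Cross-correlation sums vanish at shifts `t ≥ n - K` if the two sequences agree on the first
`K` entries and are opposite on the last `K`. -/
theorem aperiodicCorr_cross_eq_zero {n K : ℕ} {e f : Fin n → ℂ}
    (h : ∀ i : Fin n, (i : ℕ) < K → e i = f i ∧ e i.rev = -f i.rev) {t : ℕ} (ht : n ≤ t + K) :
    aperiodicCorr e f t + aperiodicCorr f e t = 0 := by
  simp only [aperiodicCorr, ← Finset.sum_add_distrib]
  refine Finset.sum_eq_zero fun k _ => Finset.sum_eq_zero fun l _ => ?_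
  split_ifs with hl
  · have h₁ := (h k (by omega)).1
    have h₂ := (h l.rev (by rw [Fin.val_rev]; omega)).2
    rw [Fin.rev_rev] at h₂
    rw [h₁, h₂, map_neg]
    ring
  · simp

theorem isCZCP_insertEnds {N K : ℕ} {a b : Fin N → ℂ} (hab : IsGCP a b) (hK : K ≤ N)
    (h : ∀ i : Fin N, (i : ℕ) < K → a i = b i) (x : ℂ) :
    IsCZCP (N + N + 2) (K + 1)
      (insertEnds (Fin.append a (mate (a, b)).1) x (-starRingEnd ℂ x))
      (insertEnds (Fin.append b (mate (a, b)).2) x (starRingEnd ℂ x)) := by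
  have hG := hab.append_mate
  set e := Fin.append a (mate (a, b)).1 with he
  set f := Fin.append b (mate (a, b)).2 with hf
  have el (i : Fin N) : e (Fin.castAdd N i) = a i := Fin.append_left _ _ _
  have fl (i : Fin N) : f (Fin.castAdd N i) = b i := Fin.append_left _ _ _
  have er (i : Fin N) : e (Fin.natAdd N i) = starRingEnd ℂ (b i.rev) := Fin.append_right _ _ _
  have fr (i : Fin N) : f (Fin.natAdd N i) = -starRingEnd ℂ (a i.rev) := Fin.append_right _ _ _
  have rl (i : Fin N) : (Fin.castAdd N i).rev = Fin.natAdd N i.rev := by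
    ext; simp only [Fin.val_rev, Fin.val_castAdd, Fin.val_natAdd]; omega
  have rr (i : Fin N) : (Fin.natAdd N i).rev = Fin.castAdd N i.rev := by
    ext; simp only [Fin.val_rev, Fin.val_castAdd, Fin.val_natAdd]; omega
  have hef (i : Fin (N + N)) (hi : (i : ℕ) < K) : e i = f i ∧ e i.rev = -f i.rev := by
    obtain ⟨i, rfl⟩ : ∃ i' : Fin N, i = Fin.castAdd N i' := ⟨⟨i, by omega⟩, rfl⟩
    rw [rl, er, fr, el, fl, Fin.rev_rev, h i hi, neg_neg]
    exact ⟨rfl, rfl⟩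
  refine isCZCP_of_pos (fun t ht ht₀ => ?_) (fun t ht₁ ht₂ => ?_) (by omega)
  · obtain rfl | htn : t = N + N + 1 ∨ t < N + N + 1 := by omega
    · push_cast
      rw [← Nat.cast_add, aperiodicCorr_insertEnds_last, aperiodicCorr_insertEnds_last]
      simp
    · obtain ⟨j, rfl⟩ : ∃ j : Fin (N + N), t = j + 1 := ⟨⟨t - 1, by omega⟩, by simp only; omega⟩
      have := hG (j + 1) (by omega)
      push_cast
      rw [aperiodicCorr_insertEnds, aperiodicCorr_insertEnds]
      suffices H : starRingEnd ℂ (e j) + starRingEnd ℂ (f j) - e j.rev + f j.rev = 0 by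
        simp only [map_neg, starRingEnd_self_apply]
        linear_combination this + x * H
      obtain hj | hj : (j : ℕ) < N ∨ (j.rev : ℕ) < K := by
        rw [Fin.val_rev]; omega
      · obtain ⟨i, rfl⟩ : ∃ i' : Fin N, j = Fin.castAdd N i' := ⟨⟨j, hj⟩, rfl⟩
        rw [rl, el, fl, er, fr, Fin.rev_rev]
        ring
      · obtain ⟨h₁, h₂⟩ := hef _ hj
        rw [Fin.rev_rev] at h₂
        rw [h₁, h₂, map_neg]
        ring
  · obtain rfl | htn : t = N + N + 1 ∨ t < N + N + 1 := by omega
    · push_cast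
      rw [← Nat.cast_add, aperiodicCorr_insertEnds_last, aperiodicCorr_insertEnds_last]
      simp
    · obtain ⟨j, rfl⟩ : ∃ j : Fin (N + N), t = j + 1 := ⟨⟨t - 1, by omega⟩, by simp only; omega⟩
      have := aperiodicCorr_cross_eq_zero hef (t := j + 1) (by omega)
      push_cast at this ⊢
      rw [aperiodicCorr_insertEnds, aperiodicCorr_insertEnds]
      obtain ⟨h₁, h₂⟩ := hef j.rev (by rw [Fin.val_rev]; omega)
      rw [Fin.rev_rev] at h₂
      rw [h₁, h₂]
      simp only [map_neg, starRingEnd_self_apply]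
      linear_combination this

theorem IsBinary.conjSeq_eq {N : ℕ} {a : Fin N → ℂ} (h : IsBinary a) : conjSeq a = a := by
  funext i
  rcases h i with h | h <;> simp [conjSeq, h]

/-- A binary Golay complementary pair whose first `r / s` entries agree and whose last `r / s`
entries are opposite. -/
structure IsSeed (r s : ℕ) {M : ℕ} (B : SeqPair M) : Prop where
  fst : IsBinary B.1
  snd : IsBinary B.2
  gcp : IsGCP B.1 B.2
  agree : AgreeOppose r s B

theorem isSeed_K10 : IsSeed 4 10 K10 :=
  ⟨isBinary_K10.1, isBinary_K10.2, isGCP_K10, agreeOppose_K10⟩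

theorem isSeed_K26 : IsSeed 12 26 K26 :=
  ⟨isBinary_K26.1, isBinary_K26.2, isGCP_K26, agreeOppose_K26⟩

theorem IsSeed.turyn {r s r' s' N M : ℕ} {A : SeqPair N} {B : SeqPair M} (hA : IsSeed r' s' A)
    (hB : IsSeed r s B) : IsSeed r s (turyn A B) :=
  have h := IsBinary.turyn hA.fst hA.snd hB.fst hB.snd
  ⟨h.1, h.2, hA.gcp.turyn hB.gcp hA.fst.conjSeq_eq hA.snd.conjSeq_eq hB.fst.conjSeq_eq
    hB.snd.conjSeq_eq, hB.agree.turyn A⟩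

theorem IsTuryn10.isSeed {N : ℕ} {B : SeqPair N} (h : IsTuryn10 B) : IsSeed 4 10 B := by
  induction h with
  | base => exact isSeed_K10
  | step _ ih => exact isSeed_K10.turyn ih

theorem IsTuryn26.isSeed {N : ℕ} {B : SeqPair N} (h : IsTuryn26 B) : IsSeed 12 26 B := by
  induction h with
  | base => exact isSeed_K26
  | step _ ih => exact isSeed_K26.turyn ih

theorem IsTurynMixed.isSeed {N : ℕ} {B : SeqPair N} (h : IsTurynMixed B) : IsSeed 12 26 B := by
  induction h with
  | base => exact isSeed_K26
  | step10 _ ih => exact isSeed_K10.turyn ih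
  | step26 _ ih => exact isSeed_K26.turyn ih

theorem mainTheorem4 (N Z q : ℕ) (hq : 2 ≤ q) (a b c d : Fin N → ℂ)
    (hab :
      (∃ β : ℕ, 1 ≤ β ∧ N = 10 ^ β ∧ IsTuryn10 (a, b) ∧ Z = 4 * N / 10 + 1) ∨
      (∃ γ : ℕ, 1 ≤ γ ∧ N = 26 ^ γ ∧ IsTuryn26 (a, b) ∧ Z = 12 * N / 26 + 1) ∨
      (∃ β γ : ℕ, 1 ≤ γ ∧ N = 10 ^ β * 26 ^ γ ∧ IsTurynMixed (a, b) ∧ Z = 12 * N / 26 + 1))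
    (hcd : (c, d) = mate (a, b))
    (e f : Fin (N + N) → ℂ) (he : e = Fin.append a c) (hf : f = Fin.append b d)
    (x₀ y₀ x₁ y₁ : ℂ)
    (hx₀ : x₀ ∈ rootsU q) (hy₀ : y₀ ∈ rootsU q) (hx₁ : x₁ ∈ rootsU q) (hy₁ : y₁ ∈ rootsU q)
    (h₁ : x₀ - starRingEnd ℂ y₁ = 0) (h₂ : x₁ + starRingEnd ℂ y₀ = 0)
    (h₃ : x₀ = x₁) (h₄ : starRingEnd ℂ y₀ = -starRingEnd ℂ y₁)
    (g h : Fin (N + N + 2) → ℂ) (hg : g = insertEnds e x₀ y₀) (hh : h = insertEnds f x₁ y₁) :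
    (IsBinary a ∧ IsBinary b ∧ IsGCP a b) ∧ IsComplementaryMate a b c d ∧
      IsCZCP (N + N + 2) Z g h := by
  obtain ⟨K, hK, rfl, ha, hb, hG, hagree⟩ : ∃ K, K ≤ N ∧ Z = K + 1 ∧ IsBinary a ∧ IsBinary b ∧
      IsGCP a b ∧ ∀ i : Fin N, (i : ℕ) < K → a i = b i := by
    rcases hab with ⟨_, _, _, hT, hZ⟩ | ⟨_, _, _, hT, hZ⟩ | ⟨_, _, _, _, hT, hZ⟩
    · exact ⟨_, by omega, hZ, hT.isSeed.fst, hT.isSeed.snd, hT.isSeed.gcp,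
        fun i hi => (hT.isSeed.agree i (by omega)).1⟩
    · exact ⟨_, by omega, hZ, hT.isSeed.fst, hT.isSeed.snd, hT.isSeed.gcp,
        fun i hi => (hT.isSeed.agree i (by omega)).1⟩
    · exact ⟨_, by omega, hZ, hT.isSeed.fst, hT.isSeed.snd, hT.isSeed.gcp,
        fun i hi => (hT.isSeed.agree i (by omega)).1⟩
  obtain ⟨rfl, rfl⟩ : c = (mate (a, b)).1 ∧ d = (mate (a, b)).2 := by
    rw [← hcd]
    exact ⟨rfl, rfl⟩
  refine ⟨⟨ha, hb, hG⟩, hG.isComplementaryMate_mate, ?_⟩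
  have hy₁' : y₁ = starRingEnd ℂ x₀ := by
    rw [sub_eq_zero.1 h₁, starRingEnd_self_apply]
  have hy₀' : y₀ = -starRingEnd ℂ x₀ := by
    rw [h₃, eq_neg_of_add_eq_zero_left h₂, map_neg, starRingEnd_self_apply, neg_neg]
  rw [hg, hh, he, hf, ← h₃, hy₀', hy₁']
  exact isCZCP_insertEnds hG hK hagree x₀
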